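/- Let $K$ be a field of characteristic $0$. The Riordan group $\mathcal R$ over $K$ is the group of infinite lower triangular matrices $(d,h)=\big([x^i]\,d(x)h(x)^j\big)_{i,j\ge 0}$, where $d\in K[[x]]$ has order $0$ (i.e. $d(0)\neq 0$) and $h\in K[[x]]$ has order $1$ (i.e. $h(0)=0$, $h'(0)\ne 0$), with the matrix product; equivalently $(d,h)(l,m)=(d\cdot l(h),\,m(h))$. Let $\mathcal A=\{(1,h)\}\le\mathcal R$ be the associated (Lagrange) subgroup, and for $k\ge 2$ let $\mathcal G_k=\{(1,h): h\in x+x^kK[[x]]\}$. Write $[A,B]=A^{-1}B^{-1}AB$, $\mathcal A^{(0)}=\mathcal A$, and let $\mathcal A^{(n)}=[\mathcal A^{(n-1)},\mathcal A^{(n-1)}]$ be the derived series. Then for every $n\ge 1$: (1) $\mathcal A^{(n)}=\mathcal G_{2^n}$. (2) Every element of $\mathcal A^{(n)}$ is a commutator $[A,B]$ of elements $A,B\in\mathcal A^{(n-1)}$. (3) More precisely, let $\lambda\in K$, $\lambda\neq 0$, and, if $n=1$, assume in addition that $1+\lambda$ is nonzero and not a root of unity. Put $A=(1,\,x+\lambda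 x^{2^{n-1}})$. Then $A\in\mathcal A^{(n-1)}$, $\mathcal G_{2^{n-1}+1}\subseteq\mathcal A^{(n-1)}$, and for every element $(1,g)\in\mathcal A^{(n)}$ there is a unique $B\in\mathcal G_{2^{n-1}+1}$ such that $(1,g)=[A,B]$. -/

import Mathlib

open PowerSeries

/-- A Riordan array over `K`: a pair `(d, h)` of formal power series, `d` of order `0` and `h` of
order `1`. It stands for the infinite lower triangular matrix `Riordan.entry`, whose
`(i, j)` entry is `[x^i] d(x) h(x)^j`; see `Riordan.entry_injective` and `Riordan.entry_mul`. -/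
@[ext]
structure Riordan (K : Type*) [Field K] where
  d : PowerSeries K
  h : PowerSeries K
  d_zero : constantCoeff d ≠ 0
  h_zero : constantCoeff h = 0
  h_one : coeff 1 h ≠ 0

namespace Riordan

section

variable {K : Type*} [Field K]

theorem coeff_pow_eq_zero {h : PowerSeries K} (h0 : constantCoeff h = 0) {n k : ℕ}
    (hk : n < k) : coeff n (h ^ k) = 0 :=
  PowerSeries.X_pow_dvd_iff.1 (pow_dvd_pow_of_dvd (PowerSeries.X_dvd_iff.2 h0) k) n hk

theorem hasSubst {h : PowerSeries K} (h0 : constantCoeff h = 0) : PowerSeries.HasSubst h :=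
  HasSubst.of_constantCoeff_zero' h0

theorem coeff_subst_range {h : PowerSeries K} (h0 : constantCoeff h = 0) (f : PowerSeries K)
    (n : ℕ) : coeff n (f.subst h : PowerSeries K) =
      ∑ k ∈ Finset.range (n + 1), coeff k f * coeff n (h ^ k) := by
  rw [coeff_subst' (hasSubst h0)]
  simp only [smul_eq_mul]
  apply finsum_eq_sum_of_support_subset
  intro k hk
  by_contra hk'
  apply hk
  simp only [Finset.coe_range, Set.mem_Iio, not_lt] at hk'
  simp [coeff_pow_eq_zero h0 (show n < k by omega)]

theorem constantCoeff_subst_eq {h : PowerSeries K} (h0 : constantCoeff h = 0)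
    (f : PowerSeries K) : constantCoeff (f.subst h : PowerSeries K) = constantCoeff f := by
  rw [← coeff_zero_eq_constantCoeff_apply, coeff_subst_range h0]
  simp

theorem coeff_one_subst_eq {h : PowerSeries K} (h0 : constantCoeff h = 0)
    (f : PowerSeries K) : coeff 1 (f.subst h : PowerSeries K) = coeff 1 f * coeff 1 h := by
  rw [coeff_subst_range h0]
  simp [Finset.sum_range_succ, coeff_one]

theorem one_subst {h : PowerSeries K} (h0 : constantCoeff h = 0) :
    ((1 : PowerSeries K).subst h : PowerSeries K) = 1 := by
  rw [← coe_substAlgHom (hasSubst h0), map_one]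

/-- The compositional inverse of `a.h`. -/
noncomputable def hInv (a : Riordan K) : PowerSeries K :=
  substInvOfIsUnit a.h (isUnit_iff_ne_zero.2 a.h_one)

theorem constantCoeff_hInv (a : Riordan K) : constantCoeff a.hInv = 0 :=
  constantCoeff_substInvOfIsUnit _ _

theorem subst_hInv_right (a : Riordan K) : (a.h.subst a.hInv : PowerSeries K) = X :=
  subst_substInvOfIsUnit_right _ a.h_zero _

theorem subst_hInv_left (a : Riordan K) : (a.hInv.subst a.h : PowerSeries K) = X :=
  subst_substInvOfIsUnit_left _ a.h_zero _

theorem coeff_one_hInv_ne (a : Riordan K) : coeff 1 a.hInv ≠ 0 := by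
  intro H
  have := congrArg (coeff 1) a.subst_hInv_left
  rw [coeff_one_subst_eq a.h_zero, H] at this
  simp at this

/-- `(d, h) (l, m) = (d · l(h), m(h))`. -/
noncomputable instance : Mul (Riordan K) where
  mul a b :=
    { d := a.d * b.d.subst a.h
      h := b.h.subst a.h
      d_zero := by
        rw [map_mul, constantCoeff_subst_eq a.h_zero]
        exact mul_ne_zero a.d_zero b.d_zero
      h_zero := by rw [constantCoeff_subst_eq a.h_zero, b.h_zero]
      h_one := by
        rw [coeff_one_subst_eq a.h_zero]
        exact mul_ne_zero b.h_one a.h_one }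

/-- The identity `(1, x)`. -/
noncomputable instance : One (Riordan K) where
  one :=
    { d := 1
      h := X
      d_zero := by simp
      h_zero := by simp
      h_one := by simp }

/-- `(d, h)⁻¹ = (1 / d(h⁻¹), h⁻¹)`, where `h⁻¹` is the compositional inverse. -/
noncomputable instance : Inv (Riordan K) where
  inv a :=
    { d := (a.d.subst a.hInv : PowerSeries K)⁻¹
      h := a.hInv
      d_zero := by
        rw [constantCoeff_inv, constantCoeff_subst_eq a.constantCoeff_hInv]
        exact inv_ne_zero a.d_zero
      h_zero := a.constantCoeff_hInv
      h_one := a.coeff_one_hInv_ne }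

theorem mul_d (a b : Riordan K) : (a * b).d = a.d * b.d.subst a.h := rfl
theorem mul_h (a b : Riordan K) : (a * b).h = b.h.subst a.h := rfl
theorem one_d : (1 : Riordan K).d = 1 := rfl
theorem one_h : (1 : Riordan K).h = X := rfl
theorem inv_d (a : Riordan K) : (a⁻¹).d = (a.d.subst a.hInv : PowerSeries K)⁻¹ := rfl
theorem inv_h (a : Riordan K) : (a⁻¹).h = a.hInv := rfl

/-- The Riordan group. -/
noncomputable instance : Group (Riordan K) :=
  Group.ofLeftAxioms
    (by
      intro a b c
      ext1
      · rw [mul_d, mul_d, mul_d, mul_d, mul_h, subst_mul (hasSubst a.h_zero),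
          subst_comp_subst_apply (hasSubst b.h_zero) (hasSubst a.h_zero), mul_assoc]
      · rw [mul_h, mul_h, mul_h, mul_h,
          subst_comp_subst_apply (hasSubst b.h_zero) (hasSubst a.h_zero)])
    (by
      intro a
      ext1
      · rw [mul_d, one_d, one_h, X_subst, one_mul]
      · rw [mul_h, one_h, X_subst])
    (by
      intro a
      ext1
      · rw [mul_d, one_d, inv_d, inv_h]
        apply PowerSeries.inv_mul_cancel
        rw [constantCoeff_subst_eq a.constantCoeff_hInv]
        exact a.d_zero
      · rw [mul_h, one_h, inv_h, subst_hInv_right])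

/-- The Riordan matrix of `(d, h)`: its `(i, j)` entry is `[x^i] d(x) h(x)^j`. -/
noncomputable def entry (a : Riordan K) : Matrix ℕ ℕ K :=
  fun i j => coeff i (a.d * a.h ^ j)

theorem entry_injective : Function.Injective (entry (K := K)) := by
  intro a b hab
  have key : ∀ j, a.d * a.h ^ j = b.d * b.h ^ j := by
    intro j
    ext i
    exact congrFun (congrFun hab i) j
  have hd : a.d = b.d := by simpa using key 0
  have hne : b.d ≠ 0 := by
    intro H
    apply b.d_zero
    rw [H, map_zero]
  have hh := key 1
  rw [hd, pow_one, pow_one] at hh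
  exact Riordan.ext hd (mul_left_cancel₀ hne hh)

theorem entry_eq_zero (a : Riordan K) {i j : ℕ} (hij : i < j) : a.entry i j = 0 := by
  refine PowerSeries.X_pow_dvd_iff.1 ?_ i hij
  exact Dvd.dvd.mul_left (pow_dvd_pow_of_dvd (PowerSeries.X_dvd_iff.2 a.h_zero) j) _

/-- The group law is the product of infinite lower triangular matrices. -/
theorem entry_mul (a b : Riordan K) (i j : ℕ) :
    (a * b).entry i j = ∑ k ∈ Finset.range (i + 1), a.entry i k * b.entry k j := by
  have h1 : (a * b).d * (a * b).h ^ j = a.d * (b.d * b.h ^ j).subst a.h := by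
    rw [mul_d, mul_h, subst_mul (hasSubst a.h_zero), subst_pow (hasSubst a.h_zero), mul_assoc]
  simp only [entry]
  rw [h1]
  generalize b.d * b.h ^ j = f
  have h2 : ∀ p ∈ Finset.HasAntidiagonal.antidiagonal i, coeff p.1 a.d * coeff p.2 (f.subst a.h : PowerSeries K) =
      ∑ k ∈ Finset.range (i + 1), coeff p.1 a.d * (coeff k f * coeff p.2 (a.h ^ k)) := by
    intro p hp
    rw [coeff_subst_range a.h_zero, Finset.mul_sum]
    apply Finset.sum_subset
    · intro k hk
      have := Finset.HasAntidiagonal.mem_antidiagonal.1 hp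
      simp only [Finset.mem_range] at hk ⊢
      omega
    · intro k _ hk
      simp only [Finset.mem_range, not_lt] at hk
      rw [coeff_pow_eq_zero a.h_zero (show p.2 < k by omega)]
      ring
  rw [PowerSeries.coeff_mul, Finset.sum_congr rfl h2, Finset.sum_comm]
  apply Finset.sum_congr rfl
  intro k _
  rw [PowerSeries.coeff_mul, Finset.sum_mul]
  apply Finset.sum_congr rfl
  intro p _
  ring

end

section

variable (K : Type*) [Field K]

/-- The associated (Lagrange) subgroup `{(1, h)}` of the Riordan group. -/
noncomputable def associated : Subgroup (Riordan K) where
  carrier := {a | a.d = 1}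
  one_mem' := one_d
  mul_mem' := by
    intro a b ha hb
    simp only [Set.mem_ofPred_eq] at ha hb ⊢
    rw [mul_d, ha, hb, one_subst a.h_zero, one_mul]
  inv_mem' := by
    intro a ha
    simp only [Set.mem_ofPred_eq] at ha ⊢
    rw [inv_d, ha, one_subst a.constantCoeff_hInv]
    exact (PowerSeries.inv_eq_iff_mul_eq_one (by simp)).2 (one_mul 1)

/-- The subgroup `G_k = {(1, h) : h ∈ x + x^k K[[x]]}` of the Riordan group. -/
noncomputable def G (k : ℕ) : Subgroup (Riordan K) where
  carrier := {a | a.d = 1 ∧ ∃ u : PowerSeries K, a.h = X + X ^ k * u}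
  one_mem' := ⟨one_d, 0, by rw [one_h]; simp⟩
  mul_mem' := by
    rintro a b ⟨ha, u, hu⟩ ⟨hb, v, hv⟩
    refine ⟨(associated K).mul_mem ha hb, ?_⟩
    obtain ⟨w, hw⟩ : X ^ k ∣ a.h ^ k := pow_dvd_pow_of_dvd (PowerSeries.X_dvd_iff.2 a.h_zero) k
    refine ⟨u + w * v.subst a.h, ?_⟩
    have hs := hasSubst a.h_zero
    rw [mul_h, hv, subst_add hs, subst_mul hs, subst_pow hs, subst_X hs, hw]
    nth_rewrite 1 [hu]
    ring
  inv_mem' := by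
    rintro a ⟨ha, u, hu⟩
    refine ⟨(associated K).inv_mem ha, ?_⟩
    obtain ⟨w, hw⟩ : X ^ k ∣ a.hInv ^ k :=
      pow_dvd_pow_of_dvd (PowerSeries.X_dvd_iff.2 a.constantCoeff_hInv) k
    refine ⟨-(w * u.subst a.hInv), ?_⟩
    have hs := hasSubst a.constantCoeff_hInv
    have := a.subst_hInv_right
    rw [hu, subst_add hs, subst_mul hs, subst_pow hs, subst_X hs, hw] at this
    rw [inv_h]
    linear_combination this

/-- The `n`-th commutator subgroup `A^(n)` of the associated subgroup `A`, as a subgroup of the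
Riordan group; `A^(0) = A`. -/
noncomputable def associatedDerived (n : ℕ) : Subgroup (Riordan K) :=
  (derivedSeries (associated K) n).map (associated K).subtype

end

end Riordan

/-! Clearing inverses, `g = [a, b]` means `a * b = b * a * g`; on second components this is `b(a(x))
= g(a(b(x)))`.

Upper bound: for `a, b` in `G K m` with `m ≥ 2`, the compositions `b(a)` and `a(b)` agree modulo
`x^(2m)`, since the first cross term is symmetric in `a` and `b`. For arbitrary elements of the
associated subgroup they agree modulo `x^2`.

Converse: fix `a = x + c x^m` and `g ∈ G K (2m)`, and solve `E(b) = b(a) - g(a(b)) = 0` for `b`.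
Adding `x^k u` to `b` changes `E` by `D k * u(0) * x^(k+m-1)` plus higher terms, with `D k = c(k -
m)` if `m ≥ 2` and `D k = (1+c)^k - (1+c)` if `m = 1`. These are nonzero for `k ≥ m+1`, so the
coefficients of `b` are determined one at a time (`existsUnique_eq_zero_of_triangular`,
`existsUnique_commutator`). Thus each element of `G K (2m)` is a single commutator, and induction
with `m = 2^n` gives the derived series. -/

namespace Riordan

section

variable {K : Type*} [Field K]

/-! ### Orders of vanishing under substitution -/

theorem X_pow_dvd_pow_sub_pow {y z : PowerSeries K} (hy : X ∣ y) (hz : X ∣ z) {k : ℕ}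
    (h : X ^ k ∣ z - y) (p : ℕ) : X ^ (k + p) ∣ z ^ (p + 1) - y ^ (p + 1) := by
  induction p with
  | zero => simpa using h
  | succ p ih =>
    have e : z ^ (p + 1 + 1) - y ^ (p + 1 + 1) =
        (z ^ (p + 1) - y ^ (p + 1)) * z + (z - y) * y ^ (p + 1) := by ring
    rw [e]
    refine dvd_add ?_ ?_
    · rw [← add_assoc, pow_succ]
      exact mul_dvd_mul ih hz
    · rw [pow_add]
      exact mul_dvd_mul h (pow_dvd_pow_of_dvd hy _)

/-- If `f` has no terms of degrees `1, …, p`, then `f(z) - f(y)` vanishes to order `p` more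
than `z - y`. -/
theorem X_pow_dvd_subst_sub_subst {y z : PowerSeries K} (hy : constantCoeff y = 0)
    (hz : constantCoeff z = 0) {k p : ℕ} (h : X ^ k ∣ z - y) {f : PowerSeries K}
    (hf : ∀ j, j ≠ 0 → j ≤ p → coeff j f = 0) :
    X ^ (k + p) ∣ (f.subst z : PowerSeries K) - f.subst y := by
  rw [X_pow_dvd_iff]
  intro i hi
  rw [map_sub, coeff_subst_range hy, coeff_subst_range hz, ← Finset.sum_sub_distrib]
  refine Finset.sum_eq_zero fun j _ => ?_
  rw [← mul_sub, ← map_sub]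
  rcases Nat.eq_zero_or_pos j with rfl | hj
  · simp
  rcases le_or_gt j p with hjp | hjp
  · rw [hf j hj.ne' hjp, zero_mul]
  · obtain ⟨r, rfl⟩ : ∃ r, j = r + 1 := ⟨j - 1, by omega⟩
    rw [X_pow_dvd_iff.1 (X_pow_dvd_pow_sub_pow (X_dvd_iff.2 hy) (X_dvd_iff.2 hz) h r) i
      (by omega), mul_zero]

theorem X_pow_mul_subst {y : PowerSeries K} (hy : constantCoeff y = 0) (k : ℕ)
    (u : PowerSeries K) :
    ((X ^ k * u).subst y : PowerSeries K) = y ^ k * u.subst y := by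
  rw [subst_mul (hasSubst hy), subst_pow (hasSubst hy), subst_X (hasSubst hy)]

theorem C_subst {y : PowerSeries K} (hy : constantCoeff y = 0) (c : K) :
    ((C c : PowerSeries K).subst y : PowerSeries K) = C c := by
  ext n
  rw [coeff_subst_range hy, Finset.sum_eq_single 0]
  · simp [coeff_C, coeff_one]
  · intro j _ hj
    simp [coeff_C, hj]
  · simp

theorem X_dvd_mul_sub_C (s u : PowerSeries K) :
    X ∣ s * u - C (constantCoeff s * constantCoeff u) := by
  rw [X_dvd_iff]
  simp

/-- The first two terms of the expansion of `f(x + x^m s)` for `f = x^k u`. -/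
theorem X_pow_dvd_subst_X_add (m k : ℕ) (hm : 2 ≤ m) (s u : PowerSeries K) :
    X ^ (k + m) ∣ ((X ^ k * u).subst (X + X ^ m * s) : PowerSeries K) - X ^ k * u -
      C (k * (constantCoeff s * constantCoeff u)) * X ^ (k + (m - 1)) := by
  obtain ⟨p, rfl⟩ : ∃ p, m = p + 2 := ⟨m - 2, by omega⟩
  have ha : constantCoeff (X + X ^ (p + 2) * s : PowerSeries K) = 0 := by simp
  rw [X_pow_mul_subst ha]
  obtain ⟨v, hv⟩ : X ^ (p + 2) ∣ (u.subst (X + X ^ (p + 2) * s) : PowerSeries K) - u := by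
    have := X_pow_dvd_subst_sub_subst (y := X) (z := X + X ^ (p + 2) * s) (by simp) ha
      (k := p + 2) (p := 0) (by simp) (f := u) (by intro j h1 h2; omega)
    simpa [X_subst] using this
  obtain ⟨r, hr⟩ := Polynomial.powAddExpansion (1 : PowerSeries K) (X ^ (p + 1) * s) k
  obtain ⟨w, hw⟩ := X_dvd_mul_sub_C s u
  rw [one_pow, one_pow, mul_one] at hr
  -- With `X` factored out, the binomial expansion is taken around `1` and `X ^ k` splits off for
  -- every `k`, including `k = 0`.
  have e : (X + X ^ (p + 2) * s : PowerSeries K) = X * (1 + X ^ (p + 1) * s) := by ring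
  have hv' := sub_eq_iff_eq_add.1 hv
  rw [hv', e, mul_pow, hr]
  refine ⟨(1 + (k : PowerSeries K) * (X ^ (p + 1) * s) + r * (X ^ (p + 1) * s) ^ 2) * v +
    (k : PowerSeries K) * w +
    r * X ^ p * s ^ 2 * u, ?_⟩
  have hk : (C (k : K) : PowerSeries K) = k := by simp
  rw [map_mul, hk, show p + 2 - 1 = p + 1 by omega]
  linear_combination (k : PowerSeries K) * X ^ (k + p + 1) * hw

theorem constantCoeff_eq_zero_of_dvd {N : ℕ} (hN : 1 ≤ N) {b : PowerSeries K}
    (h : X ^ N ∣ b - X) : constantCoeff b = 0 := by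
  have h1 : (X : PowerSeries K) ∣ b - X := (dvd_pow_self X (by omega)).trans h
  have := X_dvd_iff.1 ((dvd_sub_left (dvd_refl X)).1 h1)
  exact this

/-! ### Successive approximation -/

/-- A map that acts on the coefficients of a power series in a triangular way, with nonzero
diagonal, has exactly one zero. -/
theorem existsUnique_eq_zero_of_triangular (E : PowerSeries K → PowerSeries K) (D : ℕ → K)
    (N r : ℕ) (b₀ : PowerSeries K) (hD : ∀ k, N ≤ k → D k ≠ 0)
    (h₀ : X ^ (N + r) ∣ E b₀)
    (hE : ∀ b, X ^ N ∣ b - b₀ → ∀ k, N ≤ k → ∀ u,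
      X ^ (k + r + 1) ∣ E (b + X ^ k * u) - E b - C (D k * constantCoeff u) * X ^ (k + r)) :
    ∃! b, X ^ N ∣ b - b₀ ∧ E b = 0 := by
  have hstep : ∀ b, X ^ N ∣ b - b₀ → ∀ k, N ≤ k → ∀ u, X ^ (k + r) ∣ E (b + X ^ k * u) - E b := by
    intro b hb k hk u
    have h := (pow_dvd_pow X (Nat.le_succ _)).trans (hE b hb k hk u)
    exact (dvd_sub_left (dvd_mul_left _ _)).1 h
  -- The correction at step `j` is the one that cancels the coefficient of degree `N + j + r` in
  -- `E`.
  let s : ℕ → PowerSeries K := fun j => Nat.rec b₀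
    (fun j b => b + X ^ (N + j) * C (-coeff (N + j + r) (E b) / D (N + j))) j
  have hs : ∀ j, s (j + 1) =
    s j + X ^ (N + j) * C (-coeff (N + j + r) (E (s j)) / D (N + j)) := fun j => rfl
  have hsb : ∀ j, X ^ N ∣ s j - b₀ := by
    intro j
    induction j with
    | zero => simp [s]
    | succ j ih =>
      rw [hs, add_sub_right_comm]
      exact dvd_add ih ((pow_dvd_pow X (Nat.le_add_right _ _)).mul_right _)
  have hsE : ∀ j, X ^ (N + j + r) ∣ E (s j) := by
    intro j
    induction j with
    | zero => exact h₀
    | succ j ih =>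
      set c : K := -coeff (N + j + r) (E (s j)) / D (N + j) with hc
      have h1 := hE (s j) (hsb j) (N + j) (Nat.le_add_right _ _) (C c)
      have hsc : s (j + 1) = s j + X ^ (N + j) * C c := hs j
      rw [← hsc] at h1
      have hDc : D (N + j) * c = -coeff (N + j + r) (E (s j)) :=
        mul_div_cancel₀ _ (hD _ (Nat.le_add_right _ _))
      rw [constantCoeff_C, hDc] at h1
      have h2 : X ^ (N + j + r + 1) ∣
          E (s j) + C (-coeff (N + j + r) (E (s j))) * X ^ (N + j + r) := by
        rw [X_pow_dvd_iff]
        intro i hi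
        rw [map_add, coeff_C_mul_X_pow]
        split_ifs with h
        · subst h; ring
        · rw [X_pow_dvd_iff.1 ih i (by omega), add_zero]
      have h3 := dvd_add h1 h2
      rw [show N + (j + 1) + r = N + j + r + 1 by omega]
      convert h3 using 1
      ring
  have hsj : ∀ i j, X ^ (N + j) ∣ s (j + i) - s j := by
    intro i j
    induction i with
    | zero => simp
    | succ i ih =>
      rw [← add_assoc, hs, add_sub_right_comm]
      exact dvd_add ih ((pow_dvd_pow X (by omega)).mul_right _)
  -- The limit exists because coefficients of `s j` below degree `N + j` no longer change.
  let b : PowerSeries K := PowerSeries.mk fun i : ℕ => coeff i (s (i + 1))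
  have hb : ∀ j, X ^ (N + j) ∣ b - s j := by
    intro j
    rw [X_pow_dvd_iff]
    intro i hi
    rw [map_sub, coeff_mk]
    rcases le_total (i + 1) j with h | h
    · obtain ⟨l, rfl⟩ := Nat.exists_eq_add_of_le h
      have := X_pow_dvd_iff.1 (hsj l (i + 1)) i (by omega)
      rw [map_sub] at this
      rw [← neg_sub, this, neg_zero]
    · obtain ⟨l, hl⟩ := Nat.exists_eq_add_of_le h
      have := X_pow_dvd_iff.1 (hsj l j) i hi
      rwa [map_sub, ← hl] at this
  have hb0 : X ^ N ∣ b - b₀ := hb 0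
  have hbE : E b = 0 := by
    ext i
    obtain ⟨u, hu⟩ := hb (i + 1)
    have h1 := hstep (s (i + 1)) (hsb (i + 1)) (N + (i + 1)) (by omega) u
    rw [← hu, add_sub_cancel] at h1
    have h2 := dvd_add h1 (hsE (i + 1))
    rw [sub_add_cancel] at h2
    rw [X_pow_dvd_iff.1 h2 i (by omega), map_zero]
  refine ⟨b, ⟨hb0, hbE⟩, ?_⟩
  · rintro c ⟨hc0, hcE⟩
    -- Two zeros that agree to order `N + j` differ next by a coefficient killed by `D (N + j) ≠ 0`.
    have hk : ∀ j, X ^ (N + j) ∣ c - b := by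
      intro j
      induction j with
      | zero =>
        have := dvd_sub hc0 hb0
        rwa [sub_sub_sub_cancel_right] at this
      | succ j ih =>
        obtain ⟨u, hu⟩ := ih
        have h1 := hE b hb0 (N + j) (Nat.le_add_right _ _) u
        rw [← hu, add_sub_cancel, hcE, hbE, sub_zero, zero_sub, dvd_neg] at h1
        have h2 := X_pow_dvd_iff.1 h1 (N + j + r) (Nat.lt_succ_self _)
        rw [coeff_C_mul_X_pow, if_pos rfl] at h2
        have h3 := (mul_eq_zero.1 h2).resolve_left (hD _ (Nat.le_add_right _ _))
        rw [hu, ← add_assoc, pow_succ]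
        exact mul_dvd_mul_left _ (X_dvd_iff.2 h3)
    ext i
    have := X_pow_dvd_iff.1 (hk (i + 1)) i (by omega)
    rwa [map_sub, sub_eq_zero] at this

/-! ### Commutators and the filtration `G K k` -/

theorem mem_G_iff (k : ℕ) (a : Riordan K) : a ∈ G K k ↔ a.d = 1 ∧ X ^ k ∣ a.h - X := by
  refine and_congr_right fun _ => exists_congr fun u => ?_
  rw [sub_eq_iff_eq_add']

theorem G_anti {k l : ℕ} (h : k ≤ l) : G K l ≤ G K k := by
  intro a ha
  rw [mem_G_iff] at ha ⊢
  exact ⟨ha.1, (pow_dvd_pow X h).trans ha.2⟩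

theorem G_le_associated (k : ℕ) : G K k ≤ associated K := fun _ ha => ha.1

theorem eq_commutator_iff {a b g : Riordan K} (ha : a.d = 1) (hb : b.d = 1) (hg : g.d = 1) :
    g = a⁻¹ * b⁻¹ * a * b ↔ (b.h.subst a.h : PowerSeries K) = g.h.subst (a.h.subst b.h) := by
  have h1 : g = a⁻¹ * b⁻¹ * a * b ↔ a * b = b * a * g := by
    constructor
    · rintro rfl; group
    · intro h
      rw [mul_assoc, h]; group
  have hd : (a * b).d = (b * a * g).d := by
    have hA : a ∈ associated K := ha
    have hB : b ∈ associated K := hb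
    have hG : g ∈ associated K := hg
    exact ((associated K).mul_mem hA hB).trans
      ((associated K).mul_mem ((associated K).mul_mem hB hA) hG).symm
  rw [h1, Riordan.ext_iff, and_iff_right hd]
  rfl

/-- Substituting the compositional inverse of `c.h` preserves the order of vanishing, so a
commutator can be estimated without computing any inverse series. -/
theorem mem_G_of_X_pow_dvd {k : ℕ} {c g : Riordan K} (hg : g.d = 1)
    (h : X ^ k ∣ (g.h.subst c.h : PowerSeries K) - c.h) : g ∈ G K k := by
  rw [mem_G_iff]
  refine ⟨hg, ?_⟩
  obtain ⟨u, hu⟩ := h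
  have hi := hasSubst c.constantCoeff_hInv
  have e : (g.h : PowerSeries K) - X = ((X ^ k * u).subst c.hInv : PowerSeries K) := by
    rw [← hu, sub_eq_add_neg, sub_eq_add_neg, subst_add hi,
      subst_comp_subst_apply (hasSubst c.h_zero) hi, subst_hInv_right, X_subst,
      ← coe_substAlgHom hi, map_neg, coe_substAlgHom hi, subst_hInv_right]
  rw [e, X_pow_mul_subst c.constantCoeff_hInv]
  exact (pow_dvd_pow_of_dvd (X_dvd_iff.2 c.constantCoeff_hInv) k).mul_right _

/-- Linear coefficients multiply under composition, hence commute. -/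
theorem commutator_mem_G_two {a b : Riordan K} (ha : a ∈ associated K)
    (hb : b ∈ associated K) : a⁻¹ * b⁻¹ * a * b ∈ G K 2 := by
  have hg : a⁻¹ * b⁻¹ * a * b ∈ associated K :=
    mul_mem (mul_mem (mul_mem (inv_mem ha) (inv_mem hb)) ha) hb
  refine mem_G_of_X_pow_dvd (c := b * a) hg ?_
  have h := (eq_commutator_iff ha hb hg).1 rfl
  rw [mul_h b a, ← h, X_pow_dvd_iff]
  intro i hi
  rw [map_sub]
  interval_cases i
  · rw [coeff_zero_eq_constantCoeff_apply, coeff_zero_eq_constantCoeff_apply,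
      constantCoeff_subst_eq a.h_zero, constantCoeff_subst_eq b.h_zero, a.h_zero, b.h_zero,
      sub_zero]
  · rw [coeff_one_subst_eq a.h_zero, coeff_one_subst_eq b.h_zero]
    ring

/-- Modulo `x^(2m)`, both compositions equal `a.h + b.h - x + m s(0) u(0) x^(2m-1)`, which is
symmetric. -/
theorem commutator_mem_G_two_mul {m : ℕ} (hm : 2 ≤ m) {a b : Riordan K} (ha : a ∈ G K m)
    (hb : b ∈ G K m) : a⁻¹ * b⁻¹ * a * b ∈ G K (2 * m) := by
  have hg : a⁻¹ * b⁻¹ * a * b ∈ associated K := G_le_associated m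
    (mul_mem (mul_mem (mul_mem (inv_mem ha) (inv_mem hb)) ha) hb)
  refine mem_G_of_X_pow_dvd (c := b * a) hg ?_
  have h := (eq_commutator_iff ha.1 hb.1 hg).1 rfl
  rw [mul_h b a, ← h]
  obtain ⟨-, s, hs⟩ := ha
  obtain ⟨-, u, hu⟩ := hb
  have hsa := hasSubst a.h_zero
  have hsb := hasSubst b.h_zero
  have h1 := X_pow_dvd_subst_X_add m m hm s u
  have h2 := X_pow_dvd_subst_X_add m m hm u s
  rw [← hs] at h1
  rw [← hu] at h2
  have e1 : (b.h.subst a.h : PowerSeries K) = a.h + (X ^ m * u).subst a.h := by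
    conv_lhs => rw [hu]
    rw [subst_add hsa, subst_X hsa]
  have e2 : (a.h.subst b.h : PowerSeries K) = b.h + (X ^ m * s).subst b.h := by
    conv_lhs => rw [hs]
    rw [subst_add hsb, subst_X hsb]
  rw [e1, e2, two_mul]
  convert dvd_sub h1 h2 using 1
  rw [mul_comm (constantCoeff u)]
  linear_combination hs - hu

/-! ### Solving the commutator equation -/

theorem G_commutator_equation {a g : PowerSeries K} {m : ℕ} (hm : 1 ≤ m) (c : K)
    (D : ℕ → K) (ha : a = X + C c * X ^ m) (hg : X ^ (2 * m) ∣ g - X)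
    (hD : ∀ k, m + 1 ≤ k → D k ≠ 0)
    (H : ∀ b, X ^ (m + 1) ∣ b - X → ∀ k, m + 1 ≤ k → ∀ u, X ^ (k + m) ∣
      ((X ^ k * u).subst a : PowerSeries K) -
        (X ^ k * u + C c * ((b + X ^ k * u) ^ m - b ^ m)) -
        C (D k * constantCoeff u) * X ^ (k + (m - 1))) :
    ∃! b : PowerSeries K, X ^ (m + 1) ∣ b - X ∧
      (b.subst a : PowerSeries K) - g.subst (a.subst b) = 0 := by
  obtain ⟨p, rfl⟩ : ∃ p, m = p + 1 := ⟨m - 1, by omega⟩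
  have ha0 : constantCoeff a = 0 := by rw [ha]; simp
  have hasub : ∀ b : PowerSeries K, constantCoeff b = 0 →
      (a.subst b : PowerSeries K) = b + C c * b ^ (p + 1) := by
    intro b hb
    rw [ha, subst_add (hasSubst hb), subst_X (hasSubst hb), subst_mul (hasSubst hb),
      subst_pow (hasSubst hb), subst_X (hasSubst hb), C_subst hb]
  have hgsub : ∀ y : PowerSeries K, constantCoeff y = 0 →
      (g.subst y : PowerSeries K) = y + (g - X).subst y := by
    intro y hy
    conv_lhs => rw [← add_sub_cancel X g]
    rw [subst_add (hasSubst hy), subst_X (hasSubst hy)]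
  -- The start is `b = X`, where `E` has order at least `2m = (m+1) + (m-1)`; the degree shift is `r
  -- = p = m - 1`.
  refine existsUnique_eq_zero_of_triangular
    (fun b => (b.subst a : PowerSeries K) - g.subst (a.subst b)) D (p + 1 + 1) p X hD ?_ ?_
  · have hX : (a.subst X : PowerSeries K) = a := by
      rw [hasub X (by simp), ha]
    obtain ⟨w, hw⟩ := hg
    simp only [subst_X (hasSubst ha0)]
    rw [hX, hgsub a ha0, hw, X_pow_mul_subst ha0, sub_add_cancel_left, dvd_neg]
    refine Dvd.dvd.mul_right ?_ _
    rw [show p + 1 + 1 + p = 2 * (p + 1) by omega]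
    exact pow_dvd_pow_of_dvd (X_dvd_iff.2 ha0) _
  · intro b hb k hk u
    have hb0 : constantCoeff b = 0 := constantCoeff_eq_zero_of_dvd (by omega) hb
    have hku : constantCoeff (X ^ k * u) = 0 := by
      rw [map_mul, map_pow, constantCoeff_X, zero_pow (by omega), zero_mul]
    have hb1 : constantCoeff (b + X ^ k * u) = 0 := by rw [map_add, hb0, hku, add_zero]
    have hy : ∀ b : PowerSeries K, constantCoeff b = 0 →
        constantCoeff (b + C c * b ^ (p + 1)) = 0 := by
      intro b hb; simp [hb]
    have hδ : X ^ k ∣ (b + X ^ k * u + C c * (b + X ^ k * u) ^ (p + 1)) -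
        (b + C c * b ^ (p + 1)) := by
      have h1 : X ^ k ∣ (b + X ^ k * u) ^ (p + 1) - b ^ (p + 1) := by
        refine Dvd.dvd.trans ?_ (sub_dvd_pow_sub_pow _ _ _)
        rw [add_sub_cancel_left]
        exact dvd_mul_right _ _
      have h2 := dvd_add (dvd_mul_right (X ^ k) u) (h1.mul_left (C c))
      convert h2 using 1
      ring
    -- Since `g - X` starts in degree `2p + 2` or later, only the linear term of `g` affects the
    -- leading change of `E`.
    have hγ := X_pow_dvd_subst_sub_subst (hy b hb0) (hy _ hb1) hδ (f := g - X) (p := 2 * p + 1)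
      (fun j _ hj => X_pow_dvd_iff.1 hg j (by omega))
    have hγ' := (pow_dvd_pow (X : PowerSeries K)
      (show k + p + 1 ≤ k + (2 * p + 1) by omega)).trans hγ
    have h3 := dvd_sub (H b hb k hk u) hγ'
    rw [hasub _ hb1, hasub _ hb0, hgsub _ (hy b hb0), hgsub _ (hy _ hb1),
      subst_add (hasSubst ha0)]
    rw [← add_assoc, Nat.add_sub_cancel] at h3
    convert h3 using 1
    ring

/-- Here `a` is the scaling by `1 + c`: composing with it on the right multiplies `x^k` by
`(1+c)^k`, on the left by `1 + c`. -/
theorem X_pow_dvd_linear_part (c : K) {b : PowerSeries K} (k : ℕ) (u : PowerSeries K) :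
    X ^ (k + 1) ∣ ((X ^ k * u).subst (X + C c * X ^ 1 : PowerSeries K) : PowerSeries K) -
        (X ^ k * u + C c * ((b + X ^ k * u) ^ 1 - b ^ 1)) -
        C (((1 + c) ^ k - (1 + c)) * constantCoeff u) * X ^ (k + (1 - 1)) := by
  have ha0 : constantCoeff (X + C c * X ^ 1 : PowerSeries K) = 0 := by simp
  rw [X_pow_mul_subst ha0]
  have e : (X + C c * X ^ 1 : PowerSeries K) ^ k = X ^ k * C ((1 + c) ^ k) := by
    rw [map_pow, ← mul_pow, map_add, map_one]
    congr 1
    ring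
  obtain ⟨w, hw⟩ : X ∣ C ((1 + c) ^ k) * (u.subst (X + C c * X ^ 1 : PowerSeries K)) -
      C (1 + c) * u - C (((1 + c) ^ k - (1 + c)) * constantCoeff u) := by
    rw [X_dvd_iff, map_sub, map_sub, map_mul, map_mul, constantCoeff_subst_eq ha0]
    simp only [constantCoeff_C]
    ring
  refine ⟨w, ?_⟩
  rw [e, Nat.sub_self, add_zero]
  have hc : (C (1 + c) : PowerSeries K) = 1 + C c := by simp
  rw [hc] at hw
  linear_combination X ^ k * hw

/-- The factor `k` comes from expanding `(x + c x^m)^k`, the factor `m` from the derivative of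
`b^m`. Their difference vanishes at `k = m`, which is why `b` is normalised to `x + O(x^(m+1))`. -/
theorem X_pow_dvd_unipotent_part {m : ℕ} (hm : 2 ≤ m) (c : K) {b : PowerSeries K}
    (hb : X ^ (m + 1) ∣ b - X) {k : ℕ} (hk : m + 1 ≤ k) (u : PowerSeries K) :
    X ^ (k + m) ∣ ((X ^ k * u).subst (X + C c * X ^ m : PowerSeries K) : PowerSeries K) -
        (X ^ k * u + C c * ((b + X ^ k * u) ^ m - b ^ m)) -
        C (c * ((k : K) - m) * constantCoeff u) * X ^ (k + (m - 1)) := by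
  have h1 := X_pow_dvd_subst_X_add m k hm (C c) u
  rw [mul_comm (X ^ m) (C c), constantCoeff_C] at h1
  obtain ⟨r, hr⟩ := Polynomial.powAddExpansion b (X ^ k * u) m
  obtain ⟨v, hv⟩ : X ^ m ∣ b ^ (m - 1) * u - C (constantCoeff u) * X ^ (m - 1) := by
    have hb0 : X ∣ b := X_dvd_iff.2 (constantCoeff_eq_zero_of_dvd (by omega) hb)
    obtain ⟨q, rfl⟩ : ∃ q, m = q + 2 := ⟨m - 2, by omega⟩
    have h2 := X_pow_dvd_pow_sub_pow (dvd_refl X) hb0 hb q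
    have h3 := (pow_dvd_pow (X : PowerSeries K)
      (show q + 2 ≤ q + 2 + 1 + q by omega)).trans h2
    have h4 : X ∣ u - C (constantCoeff u) := by rw [X_dvd_iff]; simp
    have h5 : X ^ (q + 2) ∣ X ^ (q + 1) * (u - C (constantCoeff u)) := by
      rw [pow_succ X (q + 1)]
      exact mul_dvd_mul_left _ h4
    have h6 := dvd_add (h3.mul_right u) h5
    rw [show q + 2 - 1 = q + 1 by omega]
    convert h6 using 1
    ring
  have h6 : X ^ (k + m) ∣ C c * ((b + X ^ k * u) ^ m - b ^ m) -
      C (c * m * constantCoeff u) * X ^ (k + (m - 1)) := by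
    -- The quadratic remainder has order at least `2k = k + m + l`, hence is negligible.
    obtain ⟨l, rfl⟩ := Nat.exists_eq_add_of_le (show m ≤ k by omega)
    refine ⟨C c * ((m : PowerSeries K) * v + r * X ^ l * u ^ 2), ?_⟩
    have hmC : (C (m : K) : PowerSeries K) = m := by simp
    rw [hr, map_mul, map_mul, hmC, pow_add X (m + l) (m - 1)]
    linear_combination C c * m * X ^ (m + l) * hv
  convert dvd_sub h1 h6 using 1
  have e : (C (c * ((k : K) - m) * constantCoeff u) : PowerSeries K) =
      C (k * (c * constantCoeff u)) - C (c * m * constantCoeff u) := by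
    rw [← map_sub]
    congr 1
    ring
  rw [e]
  ring

theorem existsUnique_commutator [CharZero K] {m : ℕ} (hm : 1 ≤ m) {c : K} (hc : c ≠ 0)
    (hc1 : m = 1 → 1 + c ≠ 0 ∧ ∀ k : ℕ, 1 ≤ k → (1 + c) ^ k ≠ 1) {a g : Riordan K}
    (had : a.d = 1) (hah : a.h = X + C c * X ^ m) (hg : g ∈ G K (2 * m)) :
    ∃! b : Riordan K, b ∈ G K (m + 1) ∧ g = a⁻¹ * b⁻¹ * a * b := by
  rw [mem_G_iff] at hg
  have key : ∃! b : PowerSeries K, X ^ (m + 1) ∣ b - X ∧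
      (b.subst a.h : PowerSeries K) - g.h.subst (a.h.subst b) = 0 := by
    rcases hm.eq_or_lt with rfl | hm2
    · obtain ⟨h0, h1⟩ := hc1 rfl
      refine G_commutator_equation le_rfl c (fun k => (1 + c) ^ k - (1 + c)) hah hg.2 ?_ ?_
      · intro k hk
        obtain ⟨j, rfl⟩ : ∃ j, k = j + 1 + 1 := ⟨k - 2, by omega⟩
        rw [pow_succ, ← sub_one_mul]
        exact mul_ne_zero (sub_ne_zero.2 (h1 _ (by omega))) h0
      · intro b _ k _ u
        rw [hah]
        exact X_pow_dvd_linear_part c k u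
    · refine G_commutator_equation hm c (fun k => c * ((k : K) - m)) hah hg.2 ?_ ?_
      · intro k hk
        exact mul_ne_zero hc (sub_ne_zero.2 (Nat.cast_injective.ne (by omega)))
      · intro b hb k hk u
        rw [hah]
        exact X_pow_dvd_unipotent_part hm2 c hb hk u
  obtain ⟨b, ⟨hb, hbE⟩, huniq⟩ := key
  have hb1 : coeff 1 b = 1 := by
    have := X_pow_dvd_iff.1 hb 1 (by omega)
    rw [map_sub, coeff_one_X] at this
    exact sub_eq_zero.1 this
  refine ⟨⟨1, b, by simp, constantCoeff_eq_zero_of_dvd (by omega) hb, by simp [hb1]⟩,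
    ⟨(mem_G_iff _ _).2 ⟨rfl, hb⟩, ?_⟩, ?_⟩
  · exact (eq_commutator_iff had rfl hg.1).2 (sub_eq_zero.1 hbE)
  · rintro b' ⟨hb', he⟩
    rw [mem_G_iff] at hb'
    exact Riordan.ext hb'.1 (huniq b'.h
      ⟨hb'.2, sub_eq_zero.2 ((eq_commutator_iff had hb'.1 hg.1).1 he)⟩)

/-! ### The derived series -/

theorem exists_h_eq {m : ℕ} (hm : 1 ≤ m) {c : K} (hc1 : m = 1 → 1 + c ≠ 0) :
    ∃ a : Riordan K, a.d = 1 ∧ a.h = X + C c * X ^ m := by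
  refine ⟨⟨1, X + C c * X ^ m, by simp, by simp; omega, ?_⟩, rfl, rfl⟩
  rw [map_add, coeff_one_X, coeff_C_mul_X_pow]
  split_ifs with h
  · exact hc1 h.symm
  · simp

theorem associatedDerived_zero : associatedDerived K 0 = associated K := by
  rw [associatedDerived, derivedSeries_zero, ← MonoidHom.range_eq_map, Subgroup.range_subtype]

theorem associatedDerived_succ (n : ℕ) : associatedDerived K (n + 1) =
    ⁅associatedDerived K n, associatedDerived K n⁆ := by
  rw [associatedDerived, derivedSeries_succ, Subgroup.map_commutator]
  rfl

/-- Mathlib's `⁅a, b⁆` is `a * b * a⁻¹ * b⁻¹`, so both inclusions pass to inverses of the two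
arguments. -/
theorem commutator_eq_G {H : Subgroup (Riordan K)} {k : ℕ}
    (h1 : ∀ a ∈ H, ∀ b ∈ H, a⁻¹ * b⁻¹ * a * b ∈ G K k)
    (h2 : ∀ g ∈ G K k, ∃ a ∈ H, ∃ b ∈ H, g = a⁻¹ * b⁻¹ * a * b) : ⁅H, H⁆ = G K k := by
  apply le_antisymm
  · rw [Subgroup.commutator_le]
    intro a ha b hb
    have := h1 a⁻¹ (inv_mem ha) b⁻¹ (inv_mem hb)
    rwa [inv_inv, inv_inv] at this
  · intro g hg
    obtain ⟨a, ha, b, hb, rfl⟩ := h2 g hg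
    have := Subgroup.commutator_mem_commutator (inv_mem ha) (inv_mem hb)
    rwa [commutatorElement_def, inv_inv, inv_inv] at this

theorem exists_commutator [CharZero K] {H : Subgroup (Riordan K)} {m : ℕ} (hm : 1 ≤ m)
    (hG : G K (m + 1) ≤ H)
    (hH : ∀ a : Riordan K, ∀ c : K, a.d = 1 → a.h = X + C c * X ^ m → a ∈ H) :
    ∀ g ∈ G K (2 * m), ∃ a ∈ H, ∃ b ∈ H, g = a⁻¹ * b⁻¹ * a * b := by
  intro g hg
  -- The choice `c = 1` works for every `m`: in characteristic `0`, `2` is neither zero nor a root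
  -- of unity.
  have h2 : (1 : K) + 1 ≠ 0 ∧ ∀ k : ℕ, 1 ≤ k → (1 + 1 : K) ^ k ≠ 1 := by
    refine ⟨by norm_num, fun k hk h => ?_⟩
    have h' : (2 : ℕ) ^ k = 1 := by
      rw [one_add_one_eq_two] at h
      exact_mod_cast h
    exact absurd h' (Nat.one_lt_two_pow (by omega)).ne'
  obtain ⟨a, had, hah⟩ := exists_h_eq (K := K) hm (c := 1) fun _ => h2.1
  obtain ⟨b, ⟨hb, he⟩, -⟩ := existsUnique_commutator hm one_ne_zero (fun _ => h2) had hah hg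
  exact ⟨a, hH a 1 had hah, b, hG hb, he⟩

theorem mem_G_of_h_eq {m : ℕ} {a : Riordan K} {c : K} (had : a.d = 1)
    (hah : a.h = X + C c * X ^ m) : a ∈ G K m :=
  ⟨had, C c, by rw [hah, mul_comm]⟩

theorem associatedDerived_succ_eq_G [CharZero K] (n : ℕ) :
    associatedDerived K (n + 1) = G K (2 ^ (n + 1)) := by
  induction n with
  | zero =>
    rw [associatedDerived_succ, associatedDerived_zero]
    exact commutator_eq_G (k := 2) (fun a ha b hb => commutator_mem_G_two ha hb)
      (exists_commutator (m := 1) le_rfl (G_le_associated _) fun a c ha _ => ha)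
  | succ n ih =>
    have hm : 2 ≤ 2 ^ (n + 1) := Nat.le_self_pow (Nat.succ_ne_zero n) 2
    rw [associatedDerived_succ, ih, pow_succ 2 (n + 1), mul_comm]
    generalize 2 ^ (n + 1) = m at hm
    exact commutator_eq_G (fun a ha b hb => commutator_mem_G_two_mul hm ha hb)
      (exists_commutator (by omega) (G_anti (Nat.le_succ _)) fun a c => mem_G_of_h_eq)

theorem G_le_associatedDerived [CharZero K] (n : ℕ) :
    G K (2 ^ n + 1) ≤ associatedDerived K n := by
  cases n with
  | zero =>
    rw [associatedDerived_zero]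
    exact G_le_associated _
  | succ n =>
    rw [associatedDerived_succ_eq_G]
    exact G_anti (Nat.le_succ _)

theorem mem_associatedDerived_of_h_eq [CharZero K] (n : ℕ) (a : Riordan K) (c : K)
    (had : a.d = 1) (hah : a.h = X + C c * X ^ 2 ^ n) : a ∈ associatedDerived K n := by
  cases n with
  | zero =>
    rw [associatedDerived_zero]
    exact had
  | succ n =>
    rw [associatedDerived_succ_eq_G]
    exact mem_G_of_h_eq had hah

end

end Riordan

theorem mainTheorem2 (K : Type*) [Field K] [CharZero K] (n : ℕ) (hn : 1 ≤ n) :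
    Riordan.associatedDerived K n = Riordan.G K (2 ^ n) ∧
    (∀ g ∈ Riordan.associatedDerived K n,
      ∃ a ∈ Riordan.associatedDerived K (n - 1), ∃ b ∈ Riordan.associatedDerived K (n - 1),
        g = a⁻¹ * b⁻¹ * a * b) ∧
    Riordan.G K (2 ^ (n - 1) + 1) ≤ Riordan.associatedDerived K (n - 1) ∧
    ∀ c : K, c ≠ 0 → (n = 1 → 1 + c ≠ 0 ∧ ∀ k : ℕ, 1 ≤ k → (1 + c) ^ k ≠ 1) →
      ∃ a ∈ Riordan.associatedDerived K (n - 1),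
        a.d = 1 ∧ a.h = PowerSeries.X + PowerSeries.C c * PowerSeries.X ^ (2 ^ (n - 1)) ∧
        ∀ g ∈ Riordan.associatedDerived K n,
          ∃! b : Riordan K, b ∈ Riordan.G K (2 ^ (n - 1) + 1) ∧ g = a⁻¹ * b⁻¹ * a * b := by
  obtain ⟨n, rfl⟩ : ∃ j, n = j + 1 := ⟨n - 1, by omega⟩
  have hm : 1 ≤ 2 ^ n := Nat.one_le_two_pow
  rw [Nat.add_sub_cancel, Riordan.associatedDerived_succ_eq_G, pow_succ, mul_comm]
  refine ⟨rfl, Riordan.exists_commutator hm (Riordan.G_le_associatedDerived n)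
    (Riordan.mem_associatedDerived_of_h_eq n), Riordan.G_le_associatedDerived n, ?_⟩
  intro c hc hc1
  have hc1' : 2 ^ n = 1 → 1 + c ≠ 0 ∧ ∀ k : ℕ, 1 ≤ k → (1 + c) ^ k ≠ 1 := by
    intro h
    apply hc1
    have : n = 0 := by
      by_contra hn0
      exact absurd h (Nat.one_lt_two_pow hn0).ne'
    omega
  obtain ⟨a, had, hah⟩ := Riordan.exists_h_eq hm fun h => (hc1' h).1
  exact ⟨a, Riordan.mem_associatedDerived_of_h_eq n a c had hah, had, hah,
    fun g hg => Riordan.existsUnique_commutator hm hc hc1' had hah hg⟩
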